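/- A \emph{non-autonomous iterated function system} (NAIFS) $(X,\Phi)$ is a set $X$ with a sequence $(\Phi^{(j)})_{j\ge 1}$ of collections $\Phi^{(j)}=\{\varphi^{(j)}_i:X\to X\}_{i\in I^{(j)}}$ of maps, where each $I^{(j)}$ is a non-empty finite set. For $m,n\ge 1$, a word $w=w_m w_{m+1}\cdots w_{m+n-1}\in I^{m,n}:=\prod_{j=0}^{n-1}I^{(m+j)}$ and $0\le k\le n$ put $\varphi_w^{m,k}:=\varphi^{(m+k-1)}_{w_{m+k-1}}\circ\cdots\circ\varphi^{(m)}_{w_m}$ (so $\varphi_w^{m,0}=\mathrm{id}$), and, if $d$ is a metric on $X$, $d_{w,n}(x,y):=\max_{0\le k\le n} d(\varphi_w^{m,k}(x),\varphi_w^{m,k}(y))$. For $\delta>0$, the NAIFS is \emph{$\delta$-expansive} if for every $\gamma>0$ there is $k_0\ge 1$ such that $d_{w,n}(x,y)>\delta$ for all $x,y\in X$ with $d(x,y)\ge\gamma$, all $m\ge 1$, all $n\ge k_0$ and all $w\in I^{m,n}$; it is \emph{$\ast$-expansive} if it is $\delta$-expansive for some $\delta>0$. Let $M$ be a compact (boundaryless,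 smooth) Riemannian manifold with its Riemannian distance $d$ (equal to $\infty$ between different connected components), and let $B(p,r)$ denote the open ball. A $C^1$ local diffeomorphism $f:M\to M$ is \emph{expanding} if there are $\tau>1$ and some smooth Riemannian metric on $M$ for which $\|Df(x)v\|\ge\tau\|v\|$ for all $x\in M$ and $v\in T_xM$. For $\sigma>1$ and $\rho>0$, such an $f$ has \emph{expansion factor} $\sigma$ and \emph{injectivity constant} $\rho$ if (i) for every $p\in M$, $f(B(p,\rho))$ contains a neighbourhood of the closure of $B(f(p),\rho)$; (ii) $d(f(x),f(y))\ge\sigma\, d(x,y)$ for every $p\in M$ and all $x,y\in B(p,\rho)$; (iii) for all $x,y\in M$ with $f(x)=y$ there is a $C^1$ map $h:B(y,\rho)\to M$ with $f\circ h=\mathrm{id}$, $h(y)=x$ and $d(h(y_1),h(y_2))\le\sigma^{-1}d(y_1,y_2)$ for all $y_1,y_2\in B(y,\rho)$. An NAIFS $(M,\Phi)$ is \emph{uniformly expanding} with uniform expansion factor $\sigma>1$ and injectivity constant $\rho>0$ if every map $\varphi^{(j)}_i$, $j\ge 1$, $i\in I^{(j)}$, is an expanding $C^1$ local diffeomorphism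 with expansion factor $\sigma$ and injectivity constant $\rho$. \textbf{Proposition.} Let $(M,\Phi)$ be a uniformly expanding NAIFS on a compact Riemannian manifold $M$, with uniform expansion factor $\sigma>1$ and injectivity constant $\rho>0$. Then $(M,\Phi)$ is $\ast$-expansive; in fact, it is $\rho$-expansive. -/

import Mathlib

open scoped Manifold ContDiff Topology ENNReal Bundle

noncomputable section

/-- A non-autonomous iterated function system on a set `X`: a sequence of non-empty finite
collections of self-maps of `X`. The sequence is indexed from `0`, so that `Index j` and `map j`
stand for `I^{(j+1)}` and `φ^{(j+1)}`. -/
structure NAIFS (X : Type*) where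
  Index : ℕ → Type
  finite_index : ∀ j, Finite (Index j)
  nonempty_index : ∀ j, Nonempty (Index j)
  map : ∀ j, Index j → X → X

namespace NAIFS

/-- Words of length `n` that start at time `m`: one index for each of the times
`m, m + 1, …, m + n - 1`. -/
def Word {X : Type*} (Φ : NAIFS X) (m n : ℕ) : Type :=
  (j : Fin n) → Φ.Index (m + j)

/-- The composition of the maps given by the first `k` letters of the word `w`, the first letter
being applied first; the identity for `k = 0`. -/
def comp {X : Type*} (Φ : NAIFS X) {m n : ℕ} (w : Φ.Word m n) : (k : ℕ) → k ≤ n → X → X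
  | 0, _ => id
  | k + 1, h => Φ.map (m + k) (w ⟨k, h⟩) ∘ Φ.comp w k (Nat.le_of_succ_le h)

/-- The Bowen metric of a word `w` of length `n`: the largest distance between the first `n + 1`
points of the `w`-orbits of `x` and `y`. Distances may be infinite. -/
def bowenEDist {X : Type*} [EMetricSpace X] (Φ : NAIFS X) {m n : ℕ} (w : Φ.Word m n)
    (x y : X) : ℝ≥0∞ :=
  ⨆ k : Fin (n + 1),
    edist (Φ.comp w k (Nat.le_of_lt_succ k.isLt) x) (Φ.comp w k (Nat.le_of_lt_succ k.isLt) y)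

/-- `δ`-expansivity; the threshold `k₀` depends on `γ` only. -/
def IsExpansive {X : Type*} [EMetricSpace X] (Φ : NAIFS X) (δ : ℝ) : Prop :=
  ∀ γ : ℝ, 0 < γ → ∃ k₀ : ℕ, 1 ≤ k₀ ∧
    ∀ x y : X, ENNReal.ofReal γ ≤ edist x y →
      ∀ m n : ℕ, k₀ ≤ n → ∀ w : Φ.Word m n, ENNReal.ofReal δ < Φ.bowenEDist w x y

/-- `∗`-expansivity: `δ`-expansivity for some `δ > 0`. -/
def IsStarExpansive {X : Type*} [EMetricSpace X] (Φ : NAIFS X) : Prop :=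
  ∃ δ : ℝ, 0 < δ ∧ Φ.IsExpansive δ

end NAIFS

/-- `f` is an expanding `C¹` local diffeomorphism: for some Riemannian metric `g` on `M` and some
`τ > 1`, one has `‖Df(x) v‖ ≥ τ ‖v‖` for all tangent vectors, the norms being those of `g`. -/
def IsExpandingLocalDiffeo {E : Type*} [NormedAddCommGroup E] [NormedSpace ℝ E]
    {H : Type*} [TopologicalSpace H] (I : ModelWithCorners ℝ E H)
    {M : Type*} [TopologicalSpace M] [ChartedSpace H M] [IsManifold I ∞ M]
    (f : M → M) : Prop :=
  IsLocalDiffeomorph I I 1 f ∧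
    ∃ (τ : ℝ) (g : Bundle.ContMDiffRiemannianMetric I ∞ E (fun x : M ↦ TangentSpace I x)),
      1 < τ ∧ ∀ (x : M) (v : TangentSpace I x),
        τ * √(g.inner x v v) ≤
          √(g.inner (f x) (mfderiv I I f x v) (mfderiv I I f x v))

/-- The class `𝓔(σ, ρ)` of expanding `C¹` local diffeomorphisms of `M` with expansion factor `σ`
and injectivity constant `ρ`, with respect to the distance of `M`. -/
structure IsExpandingWith {E : Type*} [NormedAddCommGroup E] [NormedSpace ℝ E]
    {H : Type*} [TopologicalSpace H] (I : ModelWithCorners ℝ E H)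
    {M : Type*} [EMetricSpace M] [ChartedSpace H M] [IsManifold I ∞ M]
    (σ ρ : ℝ) (f : M → M) : Prop where
  expanding : IsExpandingLocalDiffeo I f
  /-- The image of `B(p, ρ)` contains a neighbourhood of the closure of `B(f p, ρ)`. -/
  image_ball : ∀ p : M,
    f '' Metric.eball p (ENNReal.ofReal ρ) ∈ 𝓝ˢ (closure (Metric.eball (f p) (ENNReal.ofReal ρ)))
  /-- `f` expands distances on balls of radius `ρ`. -/
  le_edist : ∀ p : M, ∀ x ∈ Metric.eball p (ENNReal.ofReal ρ),
    ∀ y ∈ Metric.eball p (ENNReal.ofReal ρ),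
      ENNReal.ofReal σ * edist x y ≤ edist (f x) (f y)
  /-- Through each preimage `x` of `y` there is a `C¹` inverse branch `h` on `B(y, ρ)`, which
  contracts distances. Values of `h` outside the ball are irrelevant. -/
  inverse_branch : ∀ x y : M, f x = y → ∃ h : M → M,
    ContMDiffOn I I 1 h (Metric.eball y (ENNReal.ofReal ρ)) ∧
    (∀ z ∈ Metric.eball y (ENNReal.ofReal ρ), f (h z) = z) ∧
    h y = x ∧
    ∀ y₁ ∈ Metric.eball y (ENNReal.ofReal ρ), ∀ y₂ ∈ Metric.eball y (ENNReal.ofReal ρ),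
      edist (h y₁) (h y₂) ≤ ENNReal.ofReal σ⁻¹ * edist y₁ y₂

/-- `Φ` is a uniformly expanding NAIFS with uniform expansion factor `σ > 1` and injectivity
constant `ρ > 0`. -/
def NAIFS.IsUniformlyExpanding {E : Type*} [NormedAddCommGroup E] [NormedSpace ℝ E]
    {H : Type*} [TopologicalSpace H] (I : ModelWithCorners ℝ E H)
    {M : Type*} [EMetricSpace M] [ChartedSpace H M] [IsManifold I ∞ M]
    (Φ : NAIFS M) (σ ρ : ℝ) : Prop :=
  1 < σ ∧ 0 < ρ ∧ ∀ (j : ℕ) (i : Φ.Index j), IsExpandingWith I σ ρ (Φ.map j i)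

end

/-! In an almost convex space, such as a Riemannian manifold, two points at distance at most `ρ` lie
in a common open ball of radius `ρ`, so a map that expands by `σ` on such balls expands all
distances up to `ρ`. Two orbits that stay `ρ`-close for `n` steps started at distance at most
`σ⁻ⁿ ρ`, which is less than a given `γ` as soon as `n` is large. -/

/-- Almost convexity of a space with a possibly infinite distance: up to an arbitrarily small error,
the triangle inequality is an equality at points dividing the distance in any prescribed ratio.
Length spaces have this property; with non-strict inequalities it would require minimizers. -/
def IsAlmostConvexSpace (X : Type*) [PseudoEMetricSpace X] : Prop :=
  ∀ ⦃x y : X⦄ ⦃a b : ℝ≥0∞⦄, 0 < a → 0 < b → edist x y < a + b →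
    ∃ z, edist x z < a ∧ edist z y < b

section Riemannian

variable {E : Type*} [NormedAddCommGroup E] [NormedSpace ℝ E]
  {H : Type*} [TopologicalSpace H] (I : ModelWithCorners ℝ E H)
  {M : Type*} [PseudoEMetricSpace M] [ChartedSpace H M]
  [Bundle.RiemannianBundle (fun x : M ↦ TangentSpace I x)]

theorem edist_le_pathELength [IsRiemannianManifold I M] {c : ℝ → M} {s t : ℝ} (hst : s ≤ t)
    (hc : ContMDiffOn 𝓘(ℝ) I 1 c (Set.Icc s t)) :
    edist (c s) (c t) ≤ Manifold.pathELength I c s t := by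
  rw [IsRiemannianManifold.out (I := I)]
  exact Manifold.riemannianEDist_le_pathELength hc rfl rfl hst

theorem edist_add_edist_le_pathELength [IsRiemannianManifold I M] {c : ℝ → M} {s t u : ℝ}
    (hst : s ≤ t) (htu : t ≤ u) (hc : ContMDiffOn 𝓘(ℝ) I 1 c (Set.Icc s u)) :
    edist (c s) (c t) + edist (c t) (c u) ≤ Manifold.pathELength I c s u := by
  rw [← Manifold.pathELength_add hst htu]
  exact add_le_add (edist_le_pathELength I hst (hc.mono (Set.Icc_subset_Icc_right htu)))
    (edist_le_pathELength I htu (hc.mono (Set.Icc_subset_Icc_left hst)))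

variable (M) in
theorem isAlmostConvexSpace_of_isRiemannianManifold [IsRiemannianManifold I M] :
    IsAlmostConvexSpace M := by
  intro x y a b ha hb hxy
  rcases lt_or_ge (edist x y) a with hxa | hax
  · exact ⟨y, hxa, by simpa using hb⟩
  rw [IsRiemannianManifold.out (I := I) x y] at hxy
  obtain ⟨c, rfl, rfl, hc, hlength⟩ := Manifold.exists_lt_of_riemannianEDist_lt hxy
  obtain ⟨a', ha', b', hb', hlength'⟩ := ENNReal.exists_lt_add_of_lt_add hlength ha.ne' hb.ne'
  have hcont : ContinuousOn (fun t ↦ edist (c 0) (c t)) (Set.Icc 0 1) :=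
    continuous_edist.comp_continuousOn (continuousOn_const.prodMk hc.continuousOn)
  obtain ⟨t, ⟨ht0, ht1⟩, hta'⟩ : ∃ t ∈ Set.Icc (0 : ℝ) 1, edist (c 0) (c t) = a' :=
    intermediate_value_Icc zero_le_one hcont (by simpa using (ha'.trans_le hax).le)
  have hsum : a' + edist (c t) (c 1) < a' + b' :=
    calc a' + edist (c t) (c 1) = edist (c 0) (c t) + edist (c t) (c 1) := by rw [hta']
      _ ≤ Manifold.pathELength I c 0 1 := edist_add_edist_le_pathELength I ht0 ht1 hc
      _ < a' + b' := hlength'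
  exact ⟨c t, hta'.trans_lt ha', (lt_of_add_lt_add_left hsum).trans hb'⟩

end Riemannian

theorem IsAlmostConvexSpace.exists_mem_eball_of_edist_lt {X : Type*} [PseudoEMetricSpace X]
    (hX : IsAlmostConvexSpace X) {r : ℝ≥0∞} (hr : 0 < r) {x y : X} (hxy : edist x y < r + r) :
    ∃ p, x ∈ Metric.eball p r ∧ y ∈ Metric.eball p r :=
  let ⟨p, hxp, hpy⟩ := hX hr hr hxy
  ⟨p, hxp, Metric.mem_eball'.2 hpy⟩

namespace NAIFS

variable {X : Type*} [EMetricSpace X] (Φ : NAIFS X) {r s : ℝ≥0∞} {m n : ℕ}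

theorem edist_comp_le_bowenEDist (w : Φ.Word m n) {k : ℕ} (hk : k ≤ n) (x y : X) :
    edist (Φ.comp w k hk x) (Φ.comp w k hk y) ≤ Φ.bowenEDist w x y :=
  le_iSup (fun k : Fin (n + 1) ↦ edist (Φ.comp w k (Nat.le_of_lt_succ k.isLt) x)
    (Φ.comp w k (Nat.le_of_lt_succ k.isLt) y)) ⟨k, Nat.lt_succ_of_le hk⟩

theorem pow_mul_edist_le_edist_comp
    (hΦ : ∀ j i x y, edist x y ≤ r → s * edist x y ≤ edist (Φ.map j i x) (Φ.map j i y))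
    (w : Φ.Word m n) {x y : X} (hxy : Φ.bowenEDist w x y ≤ r) {k : ℕ} (hk : k ≤ n) :
    s ^ k * edist x y ≤ edist (Φ.comp w k hk x) (Φ.comp w k hk y) := by
  induction k with
  | zero => simp [comp]
  | succ k ih =>
    have hkn : k ≤ n := Nat.le_of_succ_le hk
    calc s ^ (k + 1) * edist x y = s * (s ^ k * edist x y) := by rw [pow_succ', mul_assoc]
      _ ≤ s * edist (Φ.comp w k hkn x) (Φ.comp w k hkn y) := by gcongr; exact ih hkn
      _ ≤ edist (Φ.comp w (k + 1) hk x) (Φ.comp w (k + 1) hk y) :=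
        hΦ _ _ _ _ ((Φ.edist_comp_le_bowenEDist w hkn x y).trans hxy)

theorem lt_bowenEDist_of_lt_pow_mul_edist
    (hΦ : ∀ j i x y, edist x y ≤ r → s * edist x y ≤ edist (Φ.map j i x) (Φ.map j i y))
    (w : Φ.Word m n) {x y : X} (hxy : r < s ^ n * edist x y) : r < Φ.bowenEDist w x y := by
  by_contra! hclose
  have hgrowth := Φ.pow_mul_edist_le_edist_comp hΦ w hclose le_rfl
  exact hxy.not_ge (hgrowth.trans ((Φ.edist_comp_le_bowenEDist w le_rfl x y).trans hclose))

theorem isExpansive_of_mul_edist_le {ρ : ℝ} (hs : 1 < s)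
    (hΦ : ∀ j i x y, edist x y ≤ ENNReal.ofReal ρ →
      s * edist x y ≤ edist (Φ.map j i x) (Φ.map j i y)) :
    Φ.IsExpansive ρ := by
  intro γ hγ
  have hγ' : ENNReal.ofReal γ ≠ 0 := (ENNReal.ofReal_pos.2 hγ).ne'
  have hgrowth : ∀ᶠ n in Filter.atTop, ENNReal.ofReal ρ / ENNReal.ofReal γ < s ^ n :=
    (ENNReal.tendsto_pow_atTop_nhds_top_iff.2 hs).eventually_const_lt
      (ENNReal.div_lt_top ENNReal.ofReal_ne_top hγ')
  obtain ⟨k₀, hk₀⟩ := Filter.eventually_atTop.1 hgrowth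
  refine ⟨k₀ + 1, Nat.le_add_left 1 k₀, fun x y hxy m n hn w ↦ ?_⟩
  refine Φ.lt_bowenEDist_of_lt_pow_mul_edist hΦ w ?_
  calc ENNReal.ofReal ρ < s ^ n * ENNReal.ofReal γ :=
        (ENNReal.div_lt_iff (.inl hγ') (.inl ENNReal.ofReal_ne_top)).1
          (hk₀ n (Nat.le_of_succ_le hn))
    _ ≤ s ^ n * edist x y := by gcongr

end NAIFS

theorem proposition6_general {X : Type*} [EMetricSpace X] (hX : IsAlmostConvexSpace X)
    (Φ : NAIFS X) {σ ρ : ℝ} (hσ : 1 < σ) (hρ : 0 < ρ)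
    (hΦ : ∀ j i p, ∀ x ∈ Metric.eball p (ENNReal.ofReal ρ),
      ∀ y ∈ Metric.eball p (ENNReal.ofReal ρ),
        ENNReal.ofReal σ * edist x y ≤ edist (Φ.map j i x) (Φ.map j i y)) :
    Φ.IsStarExpansive ∧ Φ.IsExpansive ρ := by
  have hρ' : 0 < ENNReal.ofReal ρ := ENNReal.ofReal_pos.2 hρ
  have hexp : Φ.IsExpansive ρ := by
    refine Φ.isExpansive_of_mul_edist_le (ENNReal.one_lt_ofReal.2 hσ) fun j i x y hxy ↦ ?_
    obtain ⟨p, hx, hy⟩ := hX.exists_mem_eball_of_edist_lt hρ'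
      (hxy.trans_lt (ENNReal.lt_add_right ENNReal.ofReal_ne_top hρ'.ne'))
    exact hΦ j i p x hx y hy
  exact ⟨⟨ρ, hρ, hexp⟩, hexp⟩

theorem proposition6
    {E : Type*} [NormedAddCommGroup E] [NormedSpace ℝ E] [FiniteDimensional ℝ E]
    {H : Type*} [TopologicalSpace H] {I : ModelWithCorners ℝ E H}
    {M : Type*} [EMetricSpace M] [CompactSpace M] [ChartedSpace H M] [IsManifold I ∞ M]
    [BoundarylessManifold I M]
    [Bundle.RiemannianBundle (fun x : M ↦ TangentSpace I x)]
    [IsContMDiffRiemannianBundle I ∞ E (fun x : M ↦ TangentSpace I x)]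
    [IsRiemannianManifold I M]
    (Φ : NAIFS M) (σ ρ : ℝ) (hΦ : Φ.IsUniformlyExpanding I σ ρ) :
    Φ.IsStarExpansive ∧ Φ.IsExpansive ρ := by
  obtain ⟨hσ, hρ, hmap⟩ := hΦ
  exact proposition6_general (isAlmostConvexSpace_of_isRiemannianManifold I M) Φ hσ hρ
    fun j i ↦ (hmap j i).le_edist
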